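/- Let $G$ be a group, regarded as a discrete group, and let $H\le G$ be a subgroup having diagonal stabilizers, that is, for all $x,y\in H$ and $z\in G$, $xzy^{-1}=z$ implies $x=y$. Then for every integer $n\ge 1$, $$\mathsf{TC}^{\mathcal D}(B_nH)\le \mathsf{TC}^{\mathcal D}(B_nG).$$ Here, for a discrete group $K$, $B_nK=E_nK/K$ is the $n$-th Milnor construction, where $E_nK$ is the $(n+1)$-fold join of the discrete space $K$, on which $K$ acts diagonally by left translation. For a path-connected space $X$, $\mathsf{TC}^{\mathcal D}(X)$ is the least integer $k\ge 0$ for which there is an open cover $X\times X=U_0\cup\dots\cup U_k$ such that for each $i$ and every basepoint $u\in U_i$, the image of $\pi_1(U_i,u)\to\pi_1(X\times X,u)$ is contained in a subgroup conjugate to the diagonal subgroup of $\pi_1(X\times X,u)\cong\pi_1(X)\times\pi_1(X)$; if no such cover exists, $\mathsf{TC}^{\mathcal D}(X)=\infty$. -/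

import Mathlib

/-! ### The join of copies of a discrete set and the Milnor constructions of a discrete group -/

/-- Two points `(g, t)` and `(g', t')` of the disjoint union of simplices `G ^ (n + 1) × Δⁿ`
represent the same point `t₀ g₀ ⊕ ⋯ ⊕ tₙ gₙ` of the join exactly when `t = t'` and `gᵢ = g'ᵢ`
for every `i` with `tᵢ ≠ 0`. -/
def joinSetoid (G : Type*) (n : ℕ) :
    Setoid (Σ _ : Fin (n + 1) → G, stdSimplex ℝ (Fin (n + 1))) where
  r p q := p.2 = q.2 ∧ ∀ i, p.2.1 i ≠ 0 → p.1 i = q.1 i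
  iseqv :=
    { refl := fun _ => ⟨rfl, fun _ _ => rfl⟩
      symm := fun {_ _} h => ⟨h.1.symm, fun i hi => (h.2 i (by rw [h.1]; exact hi)).symm⟩
      trans := fun {_ _ _} h k =>
        ⟨h.1.trans k.1, fun i hi => (h.2 i hi).trans (k.2 i (by rw [← h.1]; exact hi))⟩ }

/-- `MilnorE G n` is `E_n G`, the `(n + 1)`-fold join `G ⋆ ⋯ ⋆ G` of the discrete space `G`.
It is the quotient of `G ^ (n + 1) × Δⁿ`, where `G` is discrete, so that the product is the
disjoint union of a family of simplices `Δⁿ` indexed by `G ^ (n + 1)`. -/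
def MilnorE (G : Type*) (n : ℕ) : Type _ := Quotient (joinSetoid G n)

/-- The quotient topology on the join. -/
instance MilnorE.instTopologicalSpace (G : Type*) (n : ℕ) : TopologicalSpace (MilnorE G n) :=
  inferInstanceAs (TopologicalSpace (Quotient (joinSetoid G n)))

/-- The diagonal action `a • (t₀ g₀ ⊕ ⋯ ⊕ tₙ gₙ) = t₀ (a g₀) ⊕ ⋯ ⊕ tₙ (a gₙ)` of `G` on
`E_n G`. -/
instance MilnorE.instMulAction (G : Type*) [Group G] (n : ℕ) : MulAction G (MilnorE G n) where
  smul a := Quotient.map (fun p => ⟨fun i => a * p.1 i, p.2⟩)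
    (fun _ _ h => ⟨h.1, fun i hi => congrArg (a * ·) (h.2 i hi)⟩)
  one_smul := by
    rintro ⟨p⟩
    exact Quotient.sound ⟨rfl, fun i _ => one_mul (p.1 i)⟩
  mul_smul a b := by
    rintro ⟨p⟩
    exact Quotient.sound ⟨rfl, fun i _ => mul_assoc a b (p.1 i)⟩

/-- `MilnorB G n` is the `n`-th Milnor construction `B_n G = E_n G / G`, the orbit space of the
diagonal action. -/
def MilnorB (G : Type*) [Group G] (n : ℕ) : Type _ :=
  Quotient (MulAction.orbitRel G (MilnorE G n))

/-- The quotient topology on `B_n G`. -/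
instance MilnorB.instTopologicalSpace (G : Type*) [Group G] (n : ℕ) :
    TopologicalSpace (MilnorB G n) :=
  inferInstanceAs (TopologicalSpace (Quotient (MulAction.orbitRel G (MilnorE G n))))

/-- `B_n G` is path-connected. -/
instance MilnorB.instPathConnectedSpace (G : Type*) [Group G] (n : ℕ) :
    PathConnectedSpace (MilnorB G n) := by
  let π : (Σ _ : Fin (n + 1) → G, stdSimplex ℝ (Fin (n + 1))) → MilnorB G n :=
    fun p => Quotient.mk (MulAction.orbitRel G (MilnorE G n)) (Quotient.mk (joinSetoid G n) p)
  have hπ : Continuous π := continuous_quotient_mk'.comp continuous_quotient_mk'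
  let v : stdSimplex ℝ (Fin (n + 1)) := ⟨_, single_mem_stdSimplex ℝ 0⟩
  have key : ∀ p, Joined (π p) (π ⟨fun _ => 1, v⟩) := by
    rintro ⟨g, t⟩
    have h₁ : Joined (π ⟨g, t⟩) (π ⟨g, v⟩) := by
      obtain ⟨γ⟩ := PathConnectedSpace.joined t v
      exact ⟨γ.map (f := fun s => π ⟨g, s⟩) (hπ.comp continuous_sigmaMk)⟩
    have h₂ : π ⟨g, v⟩ = π ⟨fun _ => 1, v⟩ := by
      refine Quotient.sound (s := MulAction.orbitRel G (MilnorE G n)) ⟨g 0, ?_⟩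
      refine Quotient.sound (s := joinSetoid G n) ⟨rfl, fun i hi => ?_⟩
      have : i = 0 := by
        by_contra hne
        exact hi (by simp [v, hne])
      subst this
      exact mul_one _
    exact h₂ ▸ h₁
  refine ⟨⟨π ⟨fun _ => 1, v⟩⟩, ?_⟩
  rintro ⟨⟨p⟩⟩ ⟨⟨q⟩⟩
  exact (key p).trans (key q).symm

/-! ### `𝒟`-topological complexity -/

/-- The diagonal subgroup of `π₁(X × X, (x, x)) ≅ π₁(X, x) × π₁(X, x)`: the image of `π₁(X, x)`
under the diagonal map `X → X × X`. -/
noncomputable def diagonalSubgroup (X : Type*) [TopologicalSpace X] (x : X) :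
    Subgroup (FundamentalGroup (X × X) (x, x)) :=
  (FundamentalGroup.map ((ContinuousMap.id X).prodMk (ContinuousMap.id X)) x).range

/-- `K` is a subgroup of `π₁(X × X, u)` conjugate to the diagonal subgroup. The diagonal subgroup
is transported to the basepoint `u` along a path from a point of the diagonal; for path-connected
`X` such paths exist, and the resulting conjugacy class does not depend on the choice. -/
def IsConjDiagonal {X : Type*} [TopologicalSpace X] (u : X × X)
    (K : Subgroup (FundamentalGroup (X × X) u)) : Prop :=
  ∃ (x : X) (q : Path (x, x) u) (c : FundamentalGroup (X × X) u),
    K = ((diagonalSubgroup X x).map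
      (FundamentalGroup.fundamentalGroupMulEquivOfPath q).toMonoidHom).map
        (MulAut.conj c).toMonoidHom

/-- For every basepoint `u ∈ U`, the image of `π₁(U, u) → π₁(X × X, u)` is contained in a subgroup
conjugate to the diagonal subgroup. -/
def IsDSubset {X : Type*} [TopologicalSpace X] (U : Set (X × X)) : Prop :=
  ∀ u : U, ∃ K : Subgroup (FundamentalGroup (X × X) (u : X × X)), IsConjDiagonal (u : X × X) K ∧
    (FundamentalGroup.map (⟨Subtype.val, continuous_subtype_val⟩ : C(U, X × X)) u).range ≤ K

/-- The `𝒟`-topological complexity `TC^𝒟(X)` of a path-connected space `X`: the least `k` for which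
`X × X` has an open cover `U₀, …, U_k` as in `IsDSubset`, and `⊤` if there is no such cover. -/
noncomputable def TCD (X : Type*) [TopologicalSpace X] [PathConnectedSpace X] : ℕ∞ :=
  ⨅ (k : ℕ) (_ : ∃ U : Fin (k + 1) → Set (X × X),
    (∀ i, IsOpen (U i)) ∧ (⋃ i, U i) = Set.univ ∧ ∀ i, IsDSubset (U i)), (k : ℕ∞)

/-! ### Diagonal stabilizers -/

/-- A subgroup `H` of `G` has diagonal stabilizers: all stabilizers of the action
`(x, y) • z = x z y⁻¹` of `H × H` on `G` are contained in the diagonal of `H × H`. -/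
def Subgroup.HasDiagonalStabilizers {G : Type*} [Group G] (H : Subgroup G) : Prop :=
  ∀ x ∈ H, ∀ y ∈ H, ∀ z : G, x * z * y⁻¹ = z → x = y

/-!
Let `f : B_n H → B_n G` be induced by the inclusion. It suffices that the preimage under `f × f` of
a `𝒟`-subset `U` of `B_n G × B_n G` is a `𝒟`-subset of `B_n H × B_n H`, since open covers can then
be pulled back.

By `isDSubset_iff`, `U` is a `𝒟`-subset when over each `u ∈ U` there is a path class `r` from `u.1`
to `u.2` with `γ₁ r = r γ₂` for the components `γ₁`, `γ₂` of every loop in `U` at `u`.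

* If `n ≥ 2`, then `E_n H` is simply connected. Let `e₁`, `e₂` be points of `E_n H` over `u.1`,
  `u.2`. The lifts of `γ₁`, `γ₂` that start at `e₁`, `e₂` end at `x • e₁`, `y • e₂` with `x y : H`.
  The path class `r` provided by `U` lifts to a path class in `E_n G` from the image of `e₁` to the
  `z`-translate of the image of `e₂`, for some `z : G`. The two sides of `f γ₁ r = r f γ₂` lift to
  path classes ending at the `x z`- and at the `z y`-translate of the image of `e₂`, so `x z = z y`,
  and diagonal stabilizers give `x = y`. Then the image in `B_n H` of a path from `e₁` to `e₂`
  intertwines `γ₁` and `γ₂`, because paths in `E_n H` with the same endpoints are homotopic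
  (`MilnorB.isDSubset_preimage_map_subtype`).
* If `n = 1`, then `E_1 H` need not be simply connected, but `B_1 H` is a retract of `B_1 G`: both
  are graphs with the same two vertices, with the elements of `H` and of `G` as edges. For a
  retract the claim holds for every `𝒟`-subset (`IsDSubset.preimage_of_leftInverse`).

That `E_n G` is simply connected for `n ≥ 2` (`MilnorE.simplyConnectedSpace`) is shown with the
cover by the open stars of the vertices. A space is simply connected once its points are connected
to a base point by path classes that are locally compatible with all paths
(`simplyConnectedSpace_of_locally_compatible_paths`). For a point of the star of a vertex one goes
to that vertex along fixed edges and on along a straight path. This is independent of the vertex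
because any three vertices of distinct factors span a triangle, and it is compatible with the paths
in a star because a star contracts to its vertex along straight paths.
-/

open Topology unitInterval

/-! ### Path classes and simply connected spaces -/

theorem Path.Homotopic.Quotient.trans_mk_subpath {X : Type*} [TopologicalSpace X] {a b : X}
    (γ : Path a b) (t₀ t₁ t₂ : I) :
    (Path.Homotopic.Quotient.mk (γ.subpath t₀ t₁)).trans (.mk (γ.subpath t₁ t₂)) =
      .mk (γ.subpath t₀ t₂) := by
  rw [← Path.Homotopic.Quotient.mk_trans, Path.Homotopic.Quotient.eq]
  exact ⟨Path.Homotopy.subpathTransSubpath γ t₀ t₁ t₂⟩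

/-- If the path classes `c x` from a base point to the points `x` satisfy `c p · γ = c q` for all
short paths `γ : p → q`, then by subdivision they do so for all paths, so that `γ` is determined up
to homotopy by its endpoints. -/
theorem simplyConnectedSpace_of_locally_compatible_paths {X : Type*} [TopologicalSpace X]
    {b : X} (c : ∀ x, Path.Homotopic.Quotient b x)
    (h : ∀ x, ∃ U, IsOpen U ∧ x ∈ U ∧ ∀ p q (γ : Path p q), (∀ t, γ t ∈ U) →
      (c p).trans (.mk γ) = c q) :
    SimplyConnectedSpace X := by
  choose U hU hxU hc using h
  have key : ∀ {x y : X} (γ : Path x y), (c x).trans (.mk γ) = c y := by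
    intro x y γ
    obtain ⟨t, ht0, htm, ⟨N, hN⟩, ht⟩ := exists_monotone_Icc_subset_open_cover_unitInterval
      (c := fun z => γ ⁻¹' U z) (fun z => (hU z).preimage γ.continuous)
      (fun s _ => Set.mem_iUnion.2 ⟨γ s, hxU _⟩)
    have step : ∀ n, (c (γ 0)).trans (.mk (γ.subpath 0 (t n))) = c (γ (t n)) := by
      intro n
      induction n with
      | zero =>
        rw [ht0, Path.subpath_self]
        exact Path.Homotopic.Quotient.trans_refl _
      | succ n ih =>
        obtain ⟨z, hz⟩ := ht n
        rw [← Path.Homotopic.Quotient.trans_mk_subpath γ 0 (t n) (t (n + 1)),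
          ← Path.Homotopic.Quotient.trans_assoc, ih]
        refine hc z _ _ _ fun s => ?_
        have hs : γ.subpath (t n) (t (n + 1)) s ∈ γ '' Set.Icc (t n) (t (n + 1)) := by
          rw [← Path.range_subpath_of_le γ _ _ (htm n.le_succ)]
          exact Set.mem_range_self s
        obtain ⟨r, hr, hr'⟩ := hs
        rw [← hr']
        exact hz hr
    have h1 := step N
    rw [hN N le_rfl, Path.subpath_zero_one] at h1
    -- `h1` has the endpoints `γ 0` and `γ 1`, only propositionally equal to `x` and `y`.
    have aux : ∀ (x' y' : X) (hx : x' = x) (hy : y' = y),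
        (c x').trans (.mk (γ.cast hx hy)) = c y' → (c x).trans (.mk γ) = c y := by
      rintro _ _ rfl rfl h
      exact h
    exact aux _ _ _ _ h1
  rw [simply_connected_iff_paths_homotopic]
  refine ⟨⟨⟨b⟩, fun x y => ⟨((c x).symm.trans (c y)).out⟩⟩, fun x y => ⟨?_⟩⟩
  have eq : ∀ p : Path.Homotopic.Quotient x y, p = (c x).symm.trans (c y) := by
    rintro ⟨γ⟩
    rw [← key γ, ← Path.Homotopic.Quotient.trans_assoc, Path.Homotopic.Quotient.symm_trans,
      Path.Homotopic.Quotient.refl_trans]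
    rfl
  exact fun p q => (eq p).trans (eq q).symm

/-! ### `𝒟`-subsets in terms of path classes -/

section IsDSubset

open Path.Homotopic

variable {X : Type*} [TopologicalSpace X]

theorem Path.Homotopic.Quotient.map_trans {X Y : Type*} [TopologicalSpace X] [TopologicalSpace Y]
    {x y z : X} (p : Path.Homotopic.Quotient x y) (q : Path.Homotopic.Quotient y z) (f : C(X, Y)) :
    (p.trans q).map f = (p.map f).trans (q.map f) :=
  (FundamentalGroupoid.map f).map_comp (X := ⟨x⟩) (Y := ⟨y⟩) (Z := ⟨z⟩) p q

theorem Path.Homotopic.Quotient.map_symm {X Y : Type*} [TopologicalSpace X] [TopologicalSpace Y]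
    {x y : X} (p : Path.Homotopic.Quotient x y) (f : C(X, Y)) :
    p.symm.map f = (p.map f).symm := by
  obtain ⟨p⟩ := p
  rfl

theorem Path.Homotopic.Quotient.symm_trans_rev {x y z : X} (p : Path.Homotopic.Quotient x y)
    (q : Path.Homotopic.Quotient y z) : (p.trans q).symm = q.symm.trans p.symm := by
  obtain ⟨p⟩ := p
  obtain ⟨q⟩ := q
  exact congrArg Path.Homotopic.Quotient.mk (Path.trans_symm p q)

/-- The elements of a conjugate of the diagonal subgroup are the transports of the classes `(d, d)`
along a single path class from a point of the diagonal. -/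
theorem conj_fundamentalGroupMulEquivOfPath_diagonal {x : X} {u : X × X} (q : Path (x, x) u)
    (c : FundamentalGroup (X × X) u) (d : FundamentalGroup X x) :
    MulAut.conj c (FundamentalGroup.fundamentalGroupMulEquivOfPath q
      (FundamentalGroup.map ((ContinuousMap.id X).prodMk (ContinuousMap.id X)) x d)) =
    Path.Homotopic.Quotient.trans (.symm (.trans (.mk q) c))
      (.trans (Path.Homotopic.prod d d) (.trans (.mk q) c)) := by
  have h : FundamentalGroup.map ((ContinuousMap.id X).prodMk (ContinuousMap.id X)) x d =
      Path.Homotopic.prod d d := by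
    obtain ⟨d⟩ := d
    rfl
  rw [h, Path.Homotopic.Quotient.symm_trans_rev]
  simp only [Path.Homotopic.Quotient.trans_assoc]
  change Path.Homotopic.Quotient.trans (Path.Homotopic.Quotient.symm c) (.trans
        (.trans (.symm (.mk q)) (.trans (Path.Homotopic.prod d d) (.mk q))) c) = _
  simp only [Path.Homotopic.Quotient.trans_assoc]

/-- A subset of `X × X` is a `𝒟`-subset exactly when over each of its points `u` there is a path
class `r` from `u.1` to `u.2` such that the two components of any loop in the subset correspond to
each other under transport along `r`. -/
theorem isDSubset_iff {U : Set (X × X)} :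
    IsDSubset U ↔ ∀ u ∈ U, ∃ r : Path.Homotopic.Quotient u.1 u.2,
      ∀ γ : Path u u, (∀ t, γ t ∈ U) →
        (Path.Homotopic.projLeft (.mk γ)).trans r = r.trans (Path.Homotopic.projRight (.mk γ)) := by
  constructor
  · intro h u hu
    obtain ⟨K, ⟨x, q, c, rfl⟩, hK⟩ := h ⟨u, hu⟩
    -- `r` runs from `u.1` back to the diagonal along `e` and then to `u.2` along `e`.
    let e : Path.Homotopic.Quotient (x, x) u := (Path.Homotopic.Quotient.mk q).trans c
    refine ⟨(projLeft e).symm.trans (projRight e), fun γ hγ => ?_⟩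
    have hmem := hK ⟨Path.Homotopic.Quotient.mk
      (⟨⟨fun t => ⟨γ t, hγ t⟩, by fun_prop⟩, by simp, by simp⟩ : Path (⟨u, hu⟩ : U) ⟨u, hu⟩), rfl⟩
    obtain ⟨_, ⟨_, ⟨d, rfl⟩, rfl⟩, hd⟩ := hmem
    have hγ' : Path.Homotopic.Quotient.mk γ =
        e.symm.trans ((Path.Homotopic.prod d d).trans e) :=
      hd.symm.trans (conj_fundamentalGroupMulEquivOfPath_diagonal q c d)
    have hl : projLeft (Path.Homotopic.Quotient.mk γ) =
        (projLeft e).symm.trans (Path.Homotopic.Quotient.trans d (projLeft e)) := by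
      rw [hγ', projLeft, Path.Homotopic.Quotient.map_trans, Path.Homotopic.Quotient.map_trans,
        Path.Homotopic.Quotient.map_symm]
      exact congrArg _ (congrArg (Path.Homotopic.Quotient.trans · _) (projLeft_prod d d))
    have hr : projRight (Path.Homotopic.Quotient.mk γ) =
        (projRight e).symm.trans (Path.Homotopic.Quotient.trans d (projRight e)) := by
      rw [hγ', projRight, Path.Homotopic.Quotient.map_trans, Path.Homotopic.Quotient.map_trans,
        Path.Homotopic.Quotient.map_symm]
      exact congrArg _ (congrArg (Path.Homotopic.Quotient.trans · _) (projRight_prod d d))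
    rw [hl, hr]
    simp only [Path.Homotopic.Quotient.trans_assoc]
    rw [← Path.Homotopic.Quotient.trans_assoc (projLeft e), Path.Homotopic.Quotient.trans_symm,
      ← Path.Homotopic.Quotient.trans_assoc (projRight e), Path.Homotopic.Quotient.trans_symm,
      Path.Homotopic.Quotient.refl_trans, Path.Homotopic.Quotient.refl_trans]
  · intro h u
    obtain ⟨⟨u₁, u₂⟩, hu⟩ := u
    obtain ⟨r, hr⟩ := h (u₁, u₂) hu
    obtain ⟨r, rfl⟩ := Path.Homotopic.Quotient.mk_surjective r
    -- The diagonal subgroup at `(u₁, u₁)` is transported along the path that is constant in the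
    -- first component and `r` in the second.
    refine ⟨_, ⟨u₁, (Path.refl u₁).prod r, 1, rfl⟩, ?_⟩
    rintro _ ⟨⟨γ⟩, rfl⟩
    let γ' : Path (u₁, u₂) (u₁, u₂) := γ.map continuous_subtype_val
    have h1 := hr γ' fun t => (γ t).2
    let d : Path.Homotopic.Quotient u₁ u₁ := projLeft (.mk γ')
    refine ⟨_, ⟨_, ⟨d, rfl⟩, rfl⟩, ?_⟩
    refine (conj_fundamentalGroupMulEquivOfPath_diagonal _ _ _).trans ?_
    refine Eq.trans ?_ (prod_projLeft_projRight (Path.Homotopic.Quotient.mk γ'))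
    have h2 : Path.Homotopic.Quotient.trans (.mk ((Path.refl u₁).prod r))
        (1 : FundamentalGroup (X × X) (u₁, u₂)) = Path.Homotopic.prod (.refl u₁) (.mk r) := by
      exact Path.Homotopic.Quotient.trans_refl _
    have h3 : projRight (.mk γ') =
        Path.Homotopic.Quotient.trans (.symm (.mk r)) (.trans d (.mk r)) := by
      rw [show Path.Homotopic.Quotient.trans d (.mk r) = _ from h1,
        ← Path.Homotopic.Quotient.trans_assoc, Path.Homotopic.Quotient.symm_trans,
        Path.Homotopic.Quotient.refl_trans]
    rw [h2, h3]
    change Path.Homotopic.Quotient.trans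
      (Path.Homotopic.prod (.symm (.refl u₁)) (.symm (.mk r))) _ = _
    rw [comp_prod_eq_prod_comp, comp_prod_eq_prod_comp]
    have h4 : Path.Homotopic.Quotient.symm (.refl u₁) = .refl u₁ :=
      congrArg Path.Homotopic.Quotient.mk Path.refl_symm
    rw [h4, Path.Homotopic.Quotient.trans_refl, Path.Homotopic.Quotient.refl_trans]

end IsDSubset

/-! ### The topology of the Milnor constructions -/

namespace MilnorE

section Topology

variable {G K : Type*} {n : ℕ}

/-- The point `t₀ g₀ ⊕ ⋯ ⊕ tₙ gₙ` of the join. -/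
def mk (g : Fin (n + 1) → G) (t : stdSimplex ℝ (Fin (n + 1))) : MilnorE G n :=
  Quotient.mk (joinSetoid G n) ⟨g, t⟩

theorem mk_eq_mk {g g' : Fin (n + 1) → G} {t t' : stdSimplex ℝ (Fin (n + 1))} :
    mk g t = mk g' t' ↔ t = t' ∧ ∀ i, t.1 i ≠ 0 → g i = g' i :=
  Quotient.eq (r := joinSetoid G n)

theorem mk_congr {g g' : Fin (n + 1) → G} {t : stdSimplex ℝ (Fin (n + 1))}
    (h : ∀ i, t.1 i ≠ 0 → g i = g' i) : mk g t = mk g' t :=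
  mk_eq_mk.2 ⟨rfl, h⟩

theorem exists_rep (p : MilnorE G n) : ∃ g t, p = mk g t := by
  obtain ⟨⟨g, t⟩⟩ := p
  exact ⟨g, t, rfl⟩

theorem continuous_mk (g : Fin (n + 1) → G) : Continuous (mk g) :=
  continuous_quotient_mk'.comp continuous_sigmaMk

theorem continuous_iff {Y : Type*} [TopologicalSpace Y] {f : MilnorE G n → Y} :
    Continuous f ↔ ∀ g, Continuous fun t => f (mk g t) := by
  have h : IsQuotientMap (Quotient.mk (joinSetoid G n)) := isQuotientMap_quotient_mk'
  exact h.continuous_iff.trans continuous_sigma_iff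

theorem isOpen_iff {s : Set (MilnorE G n)} : IsOpen s ↔ ∀ g, IsOpen (mk g ⁻¹' s) := by
  have h : IsQuotientMap (Quotient.mk (joinSetoid G n)) := isQuotientMap_quotient_mk'
  exact h.isOpen_preimage.symm.trans isOpen_sigma_iff

/-- The map of joins induced by a family of maps of the factors. -/
def map (f : Fin (n + 1) → G → K) : C(MilnorE G n, MilnorE K n) where
  toFun := Quotient.map (fun p => ⟨fun i => f i (p.1 i), p.2⟩)
    fun _ _ h => ⟨h.1, fun i hi => congrArg (f i) (h.2 i hi)⟩
  continuous_toFun := continuous_iff.2 fun g => continuous_mk fun i => f i (g i)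

@[simp]
theorem map_mk (f : Fin (n + 1) → G → K) (g : Fin (n + 1) → G)
    (t : stdSimplex ℝ (Fin (n + 1))) : map f (mk g t) = mk (fun i => f i (g i)) t := rfl

/-- The open star of the vertex `a` of the `i`-th factor. -/
def star (i : Fin (n + 1)) (a : G) : Set (MilnorE G n) :=
  {p | ∃ g t, p = mk g t ∧ t.1 i ≠ 0 ∧ g i = a}

theorem mk_mem_star {i : Fin (n + 1)} {a : G} {g : Fin (n + 1) → G}
    {t : stdSimplex ℝ (Fin (n + 1))} : mk g t ∈ star i a ↔ t.1 i ≠ 0 ∧ g i = a := by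
  constructor
  · rintro ⟨g', t', h, ht, ha⟩
    obtain ⟨rfl, hg⟩ := mk_eq_mk.1 h
    exact ⟨ht, (hg i ht).trans ha⟩
  · exact fun h => ⟨g, t, rfl, h⟩

theorem isOpen_star (i : Fin (n + 1)) (a : G) : IsOpen (star (n := n) i a) := by
  refine isOpen_iff.2 fun g => ?_
  by_cases h : g i = a
  · have : mk g ⁻¹' star i a = {t | t.1 i ≠ 0} := by
      ext t
      simp [mk_mem_star, h]
    rw [this]
    exact isOpen_ne_fun ((continuous_apply i).comp continuous_subtype_val) continuous_const
  · have : mk g ⁻¹' star i a = ∅ := by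
      ext t
      simp [mk_mem_star, h]
    rw [this]
    exact isOpen_empty

theorem exists_mem_star (p : MilnorE G n) : ∃ i a, p ∈ star i a := by
  obtain ⟨g, t, rfl⟩ := exists_rep p
  obtain ⟨i, hi⟩ : ∃ i, t.1 i ≠ 0 := by
    by_contra! h
    have := t.2.2
    simp [h] at this
  exact ⟨i, g i, mk_mem_star.2 ⟨hi, rfl⟩⟩

end Topology

section Action

variable {G : Type*} [Group G] {n : ℕ}

theorem smul_mk (a : G) (g : Fin (n + 1) → G) (t : stdSimplex ℝ (Fin (n + 1))) :
    a • mk g t = mk (fun i => a * g i) t := rfl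

instance instContinuousConstSMul : ContinuousConstSMul G (MilnorE G n) where
  continuous_const_smul a := (map fun _ g => a * g).continuous

end Action

end MilnorE

namespace MilnorB

variable {G K : Type*} [Group G] [Group K] {n : ℕ}

/-- The projection `E_n G → B_n G`. -/
def mk : C(MilnorE G n, MilnorB G n) where
  toFun := Quotient.mk (MulAction.orbitRel G (MilnorE G n))
  continuous_toFun := continuous_quotient_mk'

theorem mk_eq_mk {p q : MilnorE G n} : mk p = mk q ↔ p ∈ MulAction.orbit G q :=
  Quotient.eq (r := MulAction.orbitRel G (MilnorE G n))

theorem mk_smul (a : G) (p : MilnorE G n) : mk (a • p) = mk p :=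
  mk_eq_mk.2 ⟨a, rfl⟩

theorem mk_surjective : Function.Surjective (mk (G := G) (n := n)) :=
  Quotient.mk_surjective

theorem isQuotientMap_mk : IsQuotientMap (mk (G := G) (n := n)) :=
  isQuotientMap_quotient_mk'

/-- `E_n G → B_n G` is a covering: distinct translates of an open star are disjoint. -/
theorem isQuotientCoveringMap_mk : IsQuotientCoveringMap (mk (G := G) (n := n)) G where
  toIsQuotientMap := isQuotientMap_mk
  toContinuousConstSMul := MilnorE.instContinuousConstSMul
  apply_eq_iff_mem_orbit := mk_eq_mk
  disjoint e := by
    obtain ⟨i, a, h⟩ := MilnorE.exists_mem_star e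
    refine ⟨_, (MilnorE.isOpen_star i a).mem_nhds h, ?_⟩
    rintro b ⟨_, ⟨p, hp, rfl⟩, hp'⟩
    obtain ⟨g, t, rfl⟩ := MilnorE.exists_rep p
    have h₁ := (MilnorE.mk_mem_star.1 hp).2
    have h₂ := (MilnorE.mk_mem_star.1 (show MilnorE.mk _ t ∈ _ from hp')).2
    exact mul_eq_right.1 (h₂.trans h₁.symm)

theorem isCoveringMap_mk : IsCoveringMap (mk (G := G) (n := n)) :=
  isQuotientCoveringMap_mk.isCoveringMap

/-- The map `B_n G → B_n K` induced by a homomorphism `G → K`. -/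
def map (φ : G →* K) : C(MilnorB G n, MilnorB K n) where
  toFun := Quotient.map (MilnorE.map fun _ => φ) (by
    rintro _ p ⟨a, rfl⟩
    obtain ⟨g, t, rfl⟩ := MilnorE.exists_rep p
    refine ⟨φ a, ?_⟩
    simp [MilnorE.smul_mk])
  continuous_toFun := isQuotientMap_mk.continuous_iff.2
    (mk.continuous.comp (MilnorE.map fun _ => φ).continuous)

end MilnorB

/-! ### Simple connectivity of joins -/

/-- If `F` contracts a map `f` to `y`, then for a path `γ` fixed by `f` pointwise the trajectories
of its endpoints under `F` differ by `γ`. -/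
theorem Path.Homotopic.Quotient.mk_trans_mk_of_homotopy_const {X : Type*} [TopologicalSpace X]
    {f : C(X, X)} {y : X} (F : f.Homotopy (.const X y)) {p q : X} (γ : Path p q)
    (hγ : ∀ s, f (γ s) = γ s) (α : Path p y) (β : Path q y) (hα : ∀ s, α s = F (s, p))
    (hβ : ∀ s, β s = F (s, q)) :
    (Path.Homotopic.Quotient.mk γ).trans (.mk β) = .mk α := by
  have hp : p = f p := by simpa using (hγ 0).symm
  have h := (Path.Homotopic.map_trans_evalAt F γ).pathCast hp (rfl : y = _)
  have h₁ : ((γ.map f.continuous).trans (F.evalAt q)).cast hp (rfl : y = _) = γ.trans β := by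
    ext s
    change (γ.map f.continuous).trans (F.evalAt q) s = _
    rw [Path.trans_apply, Path.trans_apply]
    split_ifs
    · exact hγ _
    · exact (hβ _).symm
  have h₂ : ((F.evalAt p).trans (γ.map (ContinuousMap.const X y).continuous)).cast hp
      (rfl : y = _) = α.trans (.refl y) := by
    ext s
    change (F.evalAt p).trans (γ.map (ContinuousMap.const X y).continuous) s = _
    rw [Path.trans_apply, Path.trans_apply]
    split_ifs
    · exact (hα _).symm
    · rfl
  rw [← Path.Homotopic.Quotient.trans_refl (.mk α), ← Path.Homotopic.Quotient.mk_refl,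
    ← Path.Homotopic.Quotient.mk_trans, ← Path.Homotopic.Quotient.mk_trans]
  exact Path.Homotopic.Quotient.eq.2 (h₁ ▸ h₂ ▸ h)

section Simplex

variable {ι : Type*} [Fintype ι]

instance stdSimplex.instSimplyConnectedSpace [Nonempty ι] :
    SimplyConnectedSpace (stdSimplex ℝ ι) :=
  have : ContractibleSpace (stdSimplex ℝ ι) :=
    (convex_stdSimplex ℝ ι).contractibleSpace Set.Nonempty.of_subtype
  inferInstance

/-- The straight path between two points of a simplex. -/
def stdSimplex.line (t t' : stdSimplex ℝ ι) : Path t t' where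
  toFun s := ⟨AffineMap.lineMap t.1 t'.1 (s : ℝ),
    (convex_stdSimplex ℝ ι).lineMap_mem t.2 t'.2 s.2⟩
  continuous_toFun := by
    refine Continuous.subtype_mk ?_ _
    exact AffineMap.lineMap_continuous.comp continuous_subtype_val
  source' := by simp
  target' := by simp

theorem stdSimplex.line_apply_ne_zero {t t' : stdSimplex ℝ ι} {s : I} {i : ι}
    (h : (stdSimplex.line t t' s).1 i ≠ 0) : t.1 i ≠ 0 ∨ t'.1 i ≠ 0 := by
  by_contra! h'
  apply h
  simp [stdSimplex.line, AffineMap.lineMap_apply, h'.1, h'.2]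

theorem stdSimplex.continuous_line (t' : stdSimplex ℝ ι) :
    Continuous fun p : stdSimplex ℝ ι × I => stdSimplex.line p.1 t' p.2 := by
  refine Continuous.subtype_mk ?_ _
  simp only [AffineMap.lineMap_apply_module]
  fun_prop

theorem stdSimplex.vertex_apply_ne_zero [DecidableEq ι] {i j : ι}
    (h : (stdSimplex.vertex (S := ℝ) i).1 j ≠ 0) : j = i := by
  by_contra hne
  exact h (Pi.single_eq_of_ne hne _)

end Simplex

namespace MilnorE

open stdSimplex

variable {G : Type*} {n : ℕ}

/-- The vertex `a` of the `i`-th factor of the join. -/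
def vert (i : Fin (n + 1)) (a : G) : MilnorE G n := mk (fun _ => a) (vertex i)

theorem mk_vertex (g : Fin (n + 1) → G) (i : Fin (n + 1)) :
    mk g (vertex i) = vert i (g i) :=
  mk_congr fun j hj => by rw [vertex_apply_ne_zero hj]

/-- The class of the paths inside the simplex with vertices `g` from the point with coordinates
`t` to the point with coordinates `t'`. -/
def seg (g : Fin (n + 1) → G) (t t' : stdSimplex ℝ (Fin (n + 1))) {p q : MilnorE G n}
    (hp : p = mk g t) (hq : q = mk g t') : Path.Homotopic.Quotient p q :=
  .mk (((line t t').map (continuous_mk g)).cast hp hq)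

theorem mk_map_eq_seg (g : Fin (n + 1) → G) {t t' : stdSimplex ℝ (Fin (n + 1))}
    (γ : Path t t') {p q : MilnorE G n} (hp : p = mk g t) (hq : q = mk g t') :
    Path.Homotopic.Quotient.mk ((γ.map (continuous_mk g)).cast hp hq) = seg g t t' hp hq := by
  subst hp hq
  exact Path.Homotopic.Quotient.eq.2
    ((SimplyConnectedSpace.paths_homotopic γ (line t t')).map ⟨_, continuous_mk g⟩)

theorem seg_trans (g : Fin (n + 1) → G) {t t' t'' : stdSimplex ℝ (Fin (n + 1))}
    {p q r : MilnorE G n} (hp : p = mk g t) (hq : q = mk g t') (hr : r = mk g t'') :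
    (seg g t t' hp hq).trans (seg g t' t'' hq hr) = seg g t t'' hp hr := by
  subst hp hq hr
  rw [← mk_map_eq_seg g ((line t t').trans (line t' t'')) rfl rfl]
  exact congrArg Path.Homotopic.Quotient.mk
    (Path.map_trans (line t t') (line t' t'') (continuous_mk g)).symm

theorem seg_symm (g : Fin (n + 1) → G) {t t' : stdSimplex ℝ (Fin (n + 1))}
    {p q : MilnorE G n} (hp : p = mk g t) (hq : q = mk g t') :
    (seg g t t' hp hq).symm = seg g t' t hq hp := by
  subst hp hq
  rw [← mk_map_eq_seg g (line t t').symm rfl rfl]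
  rfl

/-- A segment depends only on the vertices of the faces that contain its endpoints. -/
theorem seg_congr {g g' : Fin (n + 1) → G} {t t' : stdSimplex ℝ (Fin (n + 1))}
    {p q : MilnorE G n} (hp : p = mk g t) (hq : q = mk g t') (hp' : p = mk g' t)
    (hq' : q = mk g' t') (h : ∀ i, t.1 i ≠ 0 ∨ t'.1 i ≠ 0 → g i = g' i) :
    seg g t t' hp hq = seg g' t t' hp' hq' := by
  refine congrArg Path.Homotopic.Quotient.mk ?_
  ext s
  exact mk_congr fun i hi => h i (line_apply_ne_zero hi)

/-- The edge of the join between vertices of two different factors. -/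
def edge {i j : Fin (n + 1)} (hij : i ≠ j) (a b : G) :
    Path.Homotopic.Quotient (vert (n := n) i a) (vert j b) :=
  seg (Function.update (fun _ => a) j b) (vertex i) (vertex j)
    (by rw [mk_vertex, Function.update_of_ne hij]) (by rw [mk_vertex, Function.update_self])

theorem edge_eq_seg {i j : Fin (n + 1)} (hij : i ≠ j) {a b : G} {g : Fin (n + 1) → G}
    (ha : vert i a = mk g (vertex i)) (hb : vert j b = mk g (vertex j))
    (ha' : g i = a) (hb' : g j = b) : edge hij a b = seg g (vertex i) (vertex j) ha hb := by
  subst ha' hb'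
  refine seg_congr _ _ _ _ fun k hk => ?_
  rcases hk with hk | hk <;> rw [vertex_apply_ne_zero hk]
  · rw [Function.update_of_ne hij]
  · rw [Function.update_self]

theorem edge_symm {i j : Fin (n + 1)} (hij : i ≠ j) (a b : G) :
    (edge hij a b).symm = edge hij.symm b a := by
  have h (k c) (hk : Function.update (fun _ => a) j b k = c) :
      vert k c = mk (Function.update (fun _ => a) j b) (vertex k) := by rw [mk_vertex, hk]
  rw [edge_eq_seg hij.symm (h _ _ (by simp)) (h _ _ (by simp [hij])) (by simp) (by simp [hij])]
  exact seg_symm ..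

/-- The boundary of a triangle of the join is null-homotopic. -/
theorem edge_trans {i j k : Fin (n + 1)} (hij : i ≠ j) (hjk : j ≠ k) (hik : i ≠ k) (a b c : G) :
    (edge hij a b).trans (edge hjk b c) = edge hik a c := by
  obtain ⟨g, rfl, rfl, rfl⟩ : ∃ g : Fin (n + 1) → G, g i = a ∧ g j = b ∧ g k = c :=
    ⟨Function.update (Function.update (fun _ => a) j b) k c, by simp [*], by simp [*], by simp⟩
  have h (k) := (mk_vertex g k).symm
  rw [edge_eq_seg hij (h i) (h j) rfl rfl, edge_eq_seg hjk (h j) (h k) rfl rfl,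
    edge_eq_seg hik (h i) (h k) rfl rfl, seg_trans]

/-- For `n ≥ 2`, the vertices of the join can be connected to a base vertex by path classes that
are compatible with all the edges. -/
theorem exists_compatible_paths_to_vertices (hn : 2 ≤ n) (o : G) :
    ∃ e : ∀ i a, Path.Homotopic.Quotient (vert (n := n) 0 o) (vert i a),
      ∀ i j (hij : i ≠ j) a b, (e i a).trans (edge hij a b) = e j b := by
  obtain ⟨k, l, hk, hl, hkl⟩ : ∃ k l : Fin (n + 1), 0 ≠ k ∧ 0 ≠ l ∧ l ≠ k :=
    ⟨⟨1, by omega⟩, ⟨2, by omega⟩, by simp [Fin.ext_iff], by simp [Fin.ext_iff],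
      by simp [Fin.ext_iff]⟩
  -- Vertices outside the factor `0` are joined to the base vertex by an edge; those of the factor
  -- `0` by two edges through a vertex of the factor `k`.
  let e (i a) : Path.Homotopic.Quotient (vert (n := n) 0 o) (vert i a) :=
    if h : 0 = i then h ▸ (edge hk o o).trans (edge hk.symm o a) else edge h o a
  have e_zero (a) : e 0 a = (edge hk o o).trans (edge hk.symm o a) := by simp [e]
  have e_ne {i} (h : 0 ≠ i) (a) : e i a = edge h o a := by simp [e, h]
  have h₁ {j} (hj : 0 ≠ j) (hjk : j ≠ k) (a b) : (e 0 a).trans (edge hj a b) = e j b := by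
    rw [e_zero, e_ne hj, Path.Homotopic.Quotient.trans_assoc, edge_trans hk.symm hj hjk.symm,
      edge_trans]
  have h₂ {j} (hj : 0 ≠ j) (a b) : (e 0 a).trans (edge hj a b) = e j b := by
    by_cases hjk : j = k
    · -- The edge into the factor `k` is replaced by two edges through a third factor `l`; this is
      -- where `2 ≤ n` is needed.
      subst hjk
      rw [← edge_trans hl hkl hj a o b, ← Path.Homotopic.Quotient.trans_assoc, h₁ hl hkl,
        e_ne hl, e_ne hj, edge_trans]
    · exact h₁ hj hjk a b
  refine ⟨e, fun i j hij a b => ?_⟩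
  by_cases hi : 0 = i
  · subst hi
    exact h₂ hij a b
  by_cases hj : 0 = j
  · subst hj
    rw [← h₂ hij.symm b a, Path.Homotopic.Quotient.trans_assoc, ← edge_symm hij,
      Path.Homotopic.Quotient.symm_trans, Path.Homotopic.Quotient.trans_refl]
  · rw [e_ne hi, e_ne hj, edge_trans]

/-- The map of the join to itself that replaces the `i`-th coordinates by `a`. It is the identity
on the star of the vertex `a` of the `i`-th factor. -/
def replaceCoord (i : Fin (n + 1)) (a : G) : C(MilnorE G n, MilnorE G n) :=
  map fun j x => if j = i then a else x

theorem replaceCoord_eq_self {i : Fin (n + 1)} {a : G} {p : MilnorE G n} (h : p ∈ star i a) :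
    replaceCoord i a p = p := by
  obtain ⟨g, t, rfl, -, rfl⟩ := h
  exact mk_congr fun j _ => by grind

/-- The map `t₀ g₀ ⊕ ⋯ ⊕ tₙ gₙ ↦ (1 - s) (t₀ g₀ ⊕ ⋯ ⊕ tₙ gₙ) + s a` of the join, where first `gᵢ` is
replaced by `a` and the point is then moved towards the vertex `a` of the `i`-th factor. The replacement makes this
well defined and continuous on the whole join and not only on a star. -/
def contract (i : Fin (n + 1)) (a : G) (s : I) : MilnorE G n → MilnorE G n :=
  Quotient.map (fun p => ⟨fun j => if j = i then a else p.1 j, line p.2 (vertex i) s⟩) (by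
    rintro ⟨g, t⟩ ⟨g', _⟩ ⟨rfl, h⟩
    refine ⟨rfl, fun j hj => ?_⟩
    dsimp only
    split_ifs with hji
    · rfl
    · exact h j ((line_apply_ne_zero hj).resolve_right fun h' => hji (vertex_apply_ne_zero h')))

theorem continuous_contract (i : Fin (n + 1)) (a : G) :
    Continuous fun x : MilnorE G n × I => contract i a x.2 x.1 := by
  -- The product of a quotient map with `I` is handled by currying.
  let F (p : MilnorE G n) : C(I, MilnorE G n) := ⟨fun s => contract i a s p, by
    obtain ⟨g, t, rfl⟩ := exists_rep p
    exact (continuous_mk _).comp (line t (vertex i)).continuous⟩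
  have hF : Continuous F := continuous_iff.2 fun g =>
    ContinuousMap.continuous_of_continuous_uncurry _ <|
      (continuous_mk fun j => if j = i then a else g j).comp (continuous_line (vertex i))
  exact ContinuousMap.continuous_uncurry_of_continuous ⟨F, hF⟩

/-- The straight-line homotopy from `replaceCoord i a` to the constant map with value the vertex
`a` of the `i`-th factor. -/
def replaceCoordHomotopy (i : Fin (n + 1)) (a : G) :
    ContinuousMap.Homotopy (replaceCoord (n := n) i a) (ContinuousMap.const _ (vert i a)) where
  toFun x := contract i a x.1 x.2
  continuous_toFun := (continuous_contract i a).comp continuous_swap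
  map_zero_left p := by
    obtain ⟨g, t, rfl⟩ := exists_rep p
    exact congrArg (mk _) (line t (vertex i)).source
  map_one_left p := by
    obtain ⟨g, t, rfl⟩ := exists_rep p
    refine (congrArg (mk _) (line t (vertex i)).target).trans ?_
    rw [mk_vertex, if_pos rfl]
    rfl

/-- The straight path from a point of the star of the vertex `a` of the `i`-th factor to that
vertex. -/
def pathToVert {i : Fin (n + 1)} {a : G} {p : MilnorE G n} (h : p ∈ star i a) :
    Path p (vert i a) :=
  ((replaceCoordHomotopy i a).evalAt p).cast (replaceCoord_eq_self h).symm rfl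

/-- The class of the straight path from the vertex `a` of the `i`-th factor to a point of its
star. -/
def spoke {i : Fin (n + 1)} {a : G} {p : MilnorE G n} (h : p ∈ star i a) :
    Path.Homotopic.Quotient (vert i a) p :=
  .symm (.mk (pathToVert h))

theorem spoke_eq_seg {i : Fin (n + 1)} {a : G} {p : MilnorE G n} (h : p ∈ star i a)
    {g : Fin (n + 1) → G} {t : stdSimplex ℝ (Fin (n + 1))} (hi : vert i a = mk g (vertex i))
    (hp : p = mk g t) (ha : g i = a) : spoke h = seg g (vertex i) t hi hp := by
  rw [← seg_symm g hp hi]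
  refine congrArg (fun γ => (Path.Homotopic.Quotient.mk γ).symm) ?_
  ext s
  subst hp ha
  change mk (fun j => if j = i then g i else g j) (line t (vertex i) s) =
    mk g (line t (vertex i) s)
  exact mk_congr fun j _ => by grind

/-- Spokes are compatible with the paths inside a star. -/
theorem spoke_trans {i : Fin (n + 1)} {a : G} {p q : MilnorE G n} (γ : Path p q)
    (hγ : ∀ s, γ s ∈ star i a) (hp : p ∈ star i a) (hq : q ∈ star i a) :
    (spoke hp).trans (.mk γ) = spoke hq := by
  have h := Path.Homotopic.Quotient.mk_trans_mk_of_homotopy_const (replaceCoordHomotopy i a) γ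
    (fun s => replaceCoord_eq_self (hγ s)) (pathToVert hp) (pathToVert hq) (fun _ => rfl)
    fun _ => rfl
  rw [spoke, spoke, ← h, Path.Homotopic.Quotient.symm_trans_rev,
    Path.Homotopic.Quotient.trans_assoc, Path.Homotopic.Quotient.symm_trans,
    Path.Homotopic.Quotient.trans_refl]

theorem edge_trans_spoke {i j : Fin (n + 1)} (hij : i ≠ j) {a b : G} {p : MilnorE G n}
    (hi : p ∈ star i a) (hj : p ∈ star j b) :
    (edge hij a b).trans (spoke hj) = spoke hi := by
  obtain ⟨g, t, rfl⟩ := exists_rep p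
  obtain ⟨-, rfl⟩ := mk_mem_star.1 hi
  obtain ⟨-, rfl⟩ := mk_mem_star.1 hj
  have h (k) := (mk_vertex g k).symm
  rw [edge_eq_seg hij (h i) (h j) rfl rfl, spoke_eq_seg hj (h j) rfl rfl,
    spoke_eq_seg hi (h i) rfl rfl, seg_trans]

/-- For `n ≥ 2`, the `(n + 1)`-fold join of a nonempty discrete set is simply connected. -/
theorem simplyConnectedSpace (hn : 2 ≤ n) [Nonempty G] : SimplyConnectedSpace (MilnorE G n) := by
  obtain ⟨e, he⟩ := exists_compatible_paths_to_vertices hn (Classical.arbitrary G)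
  choose i a h using exists_mem_star (G := G) (n := n)
  have key {p : MilnorE G n} {j b k c} (hj : p ∈ star j b) (hk : p ∈ star k c) :
      (e j b).trans (spoke hj) = (e k c).trans (spoke hk) := by
    by_cases hjk : j = k
    · subst hjk
      obtain ⟨g, t, rfl⟩ := exists_rep p
      obtain ⟨-, rfl⟩ := mk_mem_star.1 hj
      obtain ⟨-, rfl⟩ := mk_mem_star.1 hk
      rfl
    · rw [← edge_trans_spoke hjk hj hk, ← Path.Homotopic.Quotient.trans_assoc, he]
  refine simplyConnectedSpace_of_locally_compatible_paths
    (fun p => (e (i p) (a p)).trans (spoke (h p))) fun x =>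
      ⟨star (i x) (a x), isOpen_star _ _, h x, fun p q γ hγ => ?_⟩
  have hp : p ∈ star (i x) (a x) := γ.source ▸ hγ 0
  have hq : q ∈ star (i x) (a x) := γ.target ▸ hγ 1
  rw [key (h p) hp, key (h q) hq, Path.Homotopic.Quotient.trans_assoc, spoke_trans γ hγ hp hq]

end MilnorE

/-! ### Lifts of path classes -/

namespace Path.Homotopic.Quotient

variable {E B E' B' : Type*} [TopologicalSpace E] [TopologicalSpace B] [TopologicalSpace E']
  [TopologicalSpace B']

/-- The path class `Γ` in `E` is a lift of the path class `γ` in `B` along `p : E → B`. The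
endpoints of the image of `Γ` are only required to be propositionally equal to those of `γ`. -/
def IsLift (p : C(E, B)) {e e' : E} {b b' : B} (Γ : Path.Homotopic.Quotient e e')
    (γ : Path.Homotopic.Quotient b b') : Prop :=
  ∃ (h : p e = b) (h' : p e' = b'), Γ.map p = γ.cast h h'

theorem map_id {b b' : B} (γ : Path.Homotopic.Quotient b b') : γ.map (.id B) = γ := by
  obtain ⟨γ⟩ := γ
  rfl

variable {p : C(E, B)} {e e' e'' : E} {b b' : B}

theorem isLift_map (Γ : Path.Homotopic.Quotient e e') : IsLift p Γ (Γ.map p) :=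
  ⟨rfl, rfl, (cast_rfl_rfl _).symm⟩

theorem IsLift.trans {Γ : Path.Homotopic.Quotient e e'} {Γ' : Path.Homotopic.Quotient e' e''}
    {γ : Path.Homotopic.Quotient b b'} {γ' : Path.Homotopic.Quotient b' b''}
    (h : IsLift p Γ γ) (h' : IsLift p Γ' γ') : IsLift p (Γ.trans Γ') (γ.trans γ') := by
  obtain ⟨rfl, rfl, h⟩ := h
  obtain ⟨_, rfl, h'⟩ := h'
  refine ⟨rfl, rfl, ?_⟩
  rw [cast_rfl_rfl] at h h' ⊢
  rw [Path.Homotopic.Quotient.map_trans, h, h']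

theorem IsLift.cast {Γ : Path.Homotopic.Quotient e e'} {γ : Path.Homotopic.Quotient b b'}
    (h : IsLift p Γ γ) {e₁ e₂ : E} (h₁ : e₁ = e) (h₂ : e₂ = e') :
    IsLift p (Γ.cast h₁ h₂) γ := by
  subst h₁ h₂
  rwa [cast_rfl_rfl]

theorem IsLift.unique {Γ : Path.Homotopic.Quotient e e'} {γ γ' : Path.Homotopic.Quotient b b'}
    (h : IsLift p Γ γ) (h' : IsLift p Γ γ') : γ = γ' := by
  obtain ⟨rfl, rfl, h⟩ := h
  obtain ⟨_, _, h'⟩ := h'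
  rw [cast_rfl_rfl] at h h'
  exact h.symm.trans h'

/-- A commutative square `p' ∘ F = f ∘ p` maps lifts along `p` to lifts along `p'`. -/
theorem IsLift.map {Γ : Path.Homotopic.Quotient e e'} {γ : Path.Homotopic.Quotient b b'}
    (h : IsLift p Γ γ) {p' : C(E', B')} (F : C(E, E')) (f : C(B, B'))
    (hF : p'.comp F = f.comp p) : IsLift p' (Γ.map F) (γ.map f) := by
  obtain ⟨rfl, rfl, h⟩ := h
  rw [cast_rfl_rfl] at h
  subst h
  refine ⟨congr($hF e), congr($hF e'), ?_⟩
  obtain ⟨Γ⟩ := Γ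
  refine congrArg Path.Homotopic.Quotient.mk ?_
  ext s
  exact congr($hF (Γ s))

/-- Lifts along a covering map with the same starting point end at the same point. -/
theorem IsLift.target_eq (hp : IsCoveringMap p) {Γ : Path.Homotopic.Quotient e e'}
    {Γ' : Path.Homotopic.Quotient e e''} {γ : Path.Homotopic.Quotient b b'}
    (h : IsLift p Γ γ) (h' : IsLift p Γ' γ) : e' = e'' := by
  obtain ⟨h₀, h₁, h⟩ := h
  obtain ⟨_, h₂, h'⟩ := h'
  have key := hp.monodromy_eq_of_map_eq (γ := γ) (ex := ⟨e, h₀⟩) (ey := ⟨e', h₁⟩) Γ h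
  have key' := hp.monodromy_eq_of_map_eq (γ := γ) (ex := ⟨e, h₀⟩) (ey := ⟨e'', h₂⟩) Γ' h'
  exact congrArg Subtype.val (key.symm.trans key')

theorem exists_isLift (hp : IsCoveringMap p) (γ : Path.Homotopic.Quotient b b') (he : p e = b) :
    ∃ (e' : E) (_ : p e' = b') (Γ : Path.Homotopic.Quotient e e'), IsLift p Γ γ :=
  ⟨_, (hp.monodromy γ ⟨e, he⟩).2, hp.liftPathQuotient γ ⟨e, he⟩, he,
    (hp.monodromy γ ⟨e, he⟩).2, hp.map_liftPathQuotient γ ⟨e, he⟩⟩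

end Path.Homotopic.Quotient

open Path.Homotopic Path.Homotopic.Quotient

/-! ### Preimages of `𝒟`-subsets -/

/-- A map under which preimages of `𝒟`-subsets are `𝒟`-subsets pulls back the covers that define
`TCD`. -/
theorem TCD_le_of_isDSubset_preimage {X Y : Type*} [TopologicalSpace X] [PathConnectedSpace X]
    [TopologicalSpace Y] [PathConnectedSpace Y] (f : C(X, Y))
    (h : ∀ U : Set (Y × Y), IsDSubset U → IsDSubset (Prod.map f f ⁻¹' U)) : TCD X ≤ TCD Y := by
  refine le_iInf₂ fun k ⟨U, hU, hcover, hD⟩ =>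
    iInf₂_le k ⟨fun i => Prod.map f f ⁻¹' U i, ?_, ?_, ?_⟩
  · exact fun i => (hU i).preimage (f.continuous.prodMap f.continuous)
  · rw [← Set.preimage_iUnion, hcover, Set.preimage_univ]
  · exact fun i => h _ (hD i)

/-- For a loop in the preimage of a `𝒟`-subset, the images of the two components correspond to each
other under transport along a path class of the target. -/
theorem IsDSubset.exists_of_preimage {X Y : Type*} [TopologicalSpace X] [TopologicalSpace Y]
    (f : C(X, Y)) {U : Set (Y × Y)} (hU : IsDSubset U) {u : X × X}
    (hu : u ∈ Prod.map f f ⁻¹' U) :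
    ∃ r : Path.Homotopic.Quotient (f u.1) (f u.2),
      ∀ γ : Path u u, (∀ t, γ t ∈ Prod.map f f ⁻¹' U) →
        ((projLeft (.mk γ)).map f).trans r = r.trans ((projRight (.mk γ)).map f) := by
  obtain ⟨r, hr⟩ := isDSubset_iff.1 hU (f u.1, f u.2) hu
  exact ⟨r, fun γ hγ => hr (γ.map (f.continuous.prodMap f.continuous)) hγ⟩

theorem IsDSubset.preimage_of_leftInverse {X Y : Type*} [TopologicalSpace X] [TopologicalSpace Y]
    (f : C(X, Y)) (g : C(Y, X)) (hg : g.comp f = .id X) {U : Set (Y × Y)} (hU : IsDSubset U) :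
    IsDSubset (Prod.map f f ⁻¹' U) := by
  refine isDSubset_iff.2 fun u hu => ?_
  obtain ⟨r, hr⟩ := hU.exists_of_preimage f hu
  -- Stated for a variable `k` in place of `g.comp f`, so that its endpoints `k u.1` and `k u.2` can
  -- be replaced by `u.1` and `u.2`.
  have aux : ∀ k : C(X, X), k = .id X → ∀ s : Path.Homotopic.Quotient (k u.1) (k u.2),
      ∃ r : Path.Homotopic.Quotient u.1 u.2,
        ∀ (γ₁ : Path.Homotopic.Quotient u.1 u.1) (γ₂ : Path.Homotopic.Quotient u.2 u.2),
          (γ₁.map k).trans s = s.trans (γ₂.map k) → γ₁.trans r = r.trans γ₂ := by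
    rintro _ rfl s
    refine ⟨s, fun γ₁ γ₂ h => ?_⟩
    rwa [map_id, map_id] at h
  obtain ⟨r', hr'⟩ := aux (g.comp f) hg (r.map g)
  refine ⟨r', fun γ hγ => hr' _ _ ?_⟩
  have h := congrArg (Path.Homotopic.Quotient.map · g) (hr γ hγ)
  simpa only [Path.Homotopic.Quotient.map_trans, Path.Homotopic.Quotient.map_comp] using h

/-! ### Preimages under `B_n H → B_n G` -/

namespace MilnorB

section Lift

variable {G K : Type*} [Group G] [Group K] {n : ℕ}

theorem exists_isLift {e e' : MilnorE G n} (γ : Path.Homotopic.Quotient (mk e) (mk e')) :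
    ∃ (a : G) (Γ : Path.Homotopic.Quotient e (a • e')), IsLift mk Γ γ := by
  obtain ⟨_, h, Γ, hΓ⟩ := Quotient.exists_isLift isCoveringMap_mk γ rfl
  obtain ⟨a, rfl⟩ := mk_eq_mk.1 h
  exact ⟨a, Γ, hΓ⟩

/-- The translates of a lift along `E_n G → B_n G` are lifts of the same path class. -/
theorem exists_isLift_smul (a : G) {e e' : MilnorE G n} {b b' : MilnorB G n}
    {Γ : Path.Homotopic.Quotient e e'} {γ : Path.Homotopic.Quotient b b'} (h : IsLift mk Γ γ) :
    ∃ Γ' : Path.Homotopic.Quotient (a • e) (a • e'), IsLift mk Γ' γ := by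
  have h' := h.map (p' := mk) ⟨(a • ·), continuous_const_smul a⟩ (.id _)
    (ContinuousMap.ext fun p => mk_smul a p)
  rw [map_id] at h'
  exact ⟨_, h'⟩

theorem _root_.MilnorE.map_smul (φ : G →* K) (a : G) (p : MilnorE G n) :
    MilnorE.map (fun _ => φ) (a • p) = φ a • MilnorE.map (fun _ => φ) p := by
  obtain ⟨g, t, rfl⟩ := MilnorE.exists_rep p
  simp [MilnorE.smul_mk]

theorem exists_isLift_map (φ : G →* K) (a : G) {e e' : MilnorE G n} {b b' : MilnorB G n}
    {Γ : Path.Homotopic.Quotient e (a • e')} {γ : Path.Homotopic.Quotient b b'}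
    (h : IsLift mk Γ γ) :
    ∃ Γ' : Path.Homotopic.Quotient (MilnorE.map (fun _ => φ) e)
      (φ a • MilnorE.map (fun _ => φ) e'), IsLift mk Γ' (γ.map (map φ)) :=
  ⟨_, (h.map (p' := mk) (MilnorE.map fun _ => φ) (map φ) rfl).cast rfl
    (MilnorE.map_smul φ a e').symm⟩

end Lift

/-- For `n ≥ 2`, the map `B_n H → B_n G` pulls `𝒟`-subsets back to `𝒟`-subsets when `H` has diagonal
stabilizers. -/
theorem isDSubset_preimage_map_subtype {G : Type*} [Group G] {H : Subgroup G}
    (hH : H.HasDiagonalStabilizers) {n : ℕ} (hn : 2 ≤ n)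
    {U : Set (MilnorB G n × MilnorB G n)} (hU : IsDSubset U) :
    IsDSubset (Prod.map (map H.subtype) (map H.subtype) ⁻¹' U) := by
  have := MilnorE.simplyConnectedSpace (G := H) hn
  refine isDSubset_iff.2 ?_
  rintro ⟨u₁, u₂⟩ hu
  obtain ⟨s, hs⟩ := hU.exists_of_preimage _ hu
  obtain ⟨e₁, rfl⟩ := mk_surjective u₁
  obtain ⟨e₂, rfl⟩ := mk_surjective u₂
  let R : Path.Homotopic.Quotient e₁ e₂ := .mk (PathConnectedSpace.somePath e₁ e₂)
  refine ⟨R.map mk, fun γ hγ => ?_⟩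
  have hc := hs γ hγ
  have hR : IsLift mk R (R.map mk) := isLift_map R
  set γ₁ : Path.Homotopic.Quotient (mk e₁) (mk e₁) := projLeft (.mk γ)
  set γ₂ : Path.Homotopic.Quotient (mk e₂) (mk e₂) := projRight (.mk γ)
  obtain ⟨x, Γ₁, hΓ₁⟩ := exists_isLift γ₁
  obtain ⟨y, Γ₂, hΓ₂⟩ := exists_isLift γ₂
  -- In `E_n G`, the lifts of the two sides of `hc` end at the translates of the image of `e₂`
  -- by `x * z` and `z * y`.
  obtain rfl : x = y := by
    obtain ⟨Γ₁', hΓ₁'⟩ := exists_isLift_map H.subtype x hΓ₁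
    obtain ⟨Γ₂', hΓ₂'⟩ := exists_isLift_map H.subtype y hΓ₂
    obtain ⟨z, S, hS⟩ := exists_isLift (e := MilnorE.map (fun _ => H.subtype) e₁)
      (e' := MilnorE.map (fun _ => H.subtype) e₂) s
    obtain ⟨S', hS'⟩ := exists_isLift_smul (x : G) hS
    obtain ⟨Γ₂'', hΓ₂''⟩ := exists_isLift_smul z hΓ₂'
    have h₁ := hΓ₁'.trans hS'
    have h₂ := hS.trans hΓ₂''
    have h := h₁.target_eq isCoveringMap_mk (hc ▸ h₂)
    have := (isQuotientCoveringMap_mk (G := G) (n := n)).isCancelSMul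
    rw [← mul_smul, ← mul_smul] at h
    have hxy : (x : G) * z = z * y := IsCancelSMul.right_cancel _ _ _ h
    exact Subtype.ext (hH x x.2 y y.2 z (by rw [hxy, mul_inv_cancel_right]))
  obtain ⟨R', hR'⟩ := exists_isLift_smul x hR
  have h₁ := hΓ₁.trans hR'
  have h₂ := hR.trans hΓ₂
  -- In the simply connected space `E_n H`, the two lifts coincide.
  rw [Subsingleton.elim (R.trans Γ₂) (Γ₁.trans R')] at h₂
  exact h₁.unique h₂

/-! ### The retraction for `n = 1` -/

/-- `B₁ G` is a graph with two vertices and the elements of `G` as edges: the point of parameter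
`t` on the edge `g` is the class of `t₀ 1 ⊕ t₁ g`. -/
def ofEdge {G : Type*} [Group G] (g : G) (t : stdSimplex ℝ (Fin 2)) : MilnorB G 1 :=
  mk (MilnorE.mk ![1, g] t)

/-- At the two ends of an edge the label of the edge is irrelevant; at the end `t₀ = 0` this holds
only up to the action of `G`. -/
theorem ofEdge_congr {G : Type*} [Group G] {a b : G} {t : stdSimplex ℝ (Fin 2)}
    (h : t.1 0 ≠ 0 → t.1 1 ≠ 0 → a = b) : ofEdge a t = ofEdge b t := by
  by_cases h₀ : t.1 0 = 0
  · refine mk_eq_mk.2 ⟨a * b⁻¹, MilnorE.mk_congr fun i hi => ?_⟩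
    fin_cases i
    · exact absurd h₀ hi
    · simp
  · refine congrArg mk (MilnorE.mk_congr fun i hi => ?_)
    fin_cases i
    · rfl
    · exact h h₀ hi

theorem mk_eq_ofEdge {G : Type*} [Group G] (g : Fin 2 → G) (t : stdSimplex ℝ (Fin 2)) :
    mk (MilnorE.mk g t) = ofEdge ((g 0)⁻¹ * g 1) t := by
  refine mk_eq_mk.2 ⟨g 0, MilnorE.mk_congr fun i _ => ?_⟩
  fin_cases i <;> simp

/-- The map `B₁ G → B₁ K` induced by a map of the sets of edges. -/
def mapOne {G K : Type*} [Group G] [Group K] (ρ : G → K) : C(MilnorB G 1, MilnorB K 1) where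
  toFun := Quotient.lift (Quotient.lift (fun p => ofEdge (ρ ((p.1 0)⁻¹ * p.1 1)) p.2) (by
      rintro ⟨g, t⟩ ⟨g', _⟩ ⟨rfl, h⟩
      exact ofEdge_congr fun h₀ h₁ => by rw [h 0 h₀, h 1 h₁])) (by
    rintro _ p ⟨a, rfl⟩
    obtain ⟨g, t, rfl⟩ := MilnorE.exists_rep p
    refine congrArg (fun b => ofEdge (ρ b) t) ?_
    change (a * g 0)⁻¹ * (a * g 1) = _
    group)
  continuous_toFun := isQuotientMap_mk.continuous_iff.2 <| MilnorE.continuous_iff.2 fun g =>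
    mk.continuous.comp (MilnorE.continuous_mk ![1, ρ ((g 0)⁻¹ * g 1)])

theorem mapOne_comp_map {G K : Type*} [Group G] [Group K] (φ : K →* G) (ρ : G → K)
    (h : ∀ x, ρ (φ x) = x) : (mapOne ρ).comp (map φ) = .id (MilnorB K 1) := by
  ext p
  obtain ⟨p, rfl⟩ := mk_surjective p
  obtain ⟨g, t, rfl⟩ := MilnorE.exists_rep p
  change ofEdge (ρ ((φ (g 0))⁻¹ * φ (g 1))) t = mk (MilnorE.mk g t)
  rw [mk_eq_ofEdge, ← map_inv, ← map_mul, h]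

end MilnorB

/-! ### Comparison of `𝒟`-topological complexities -/

theorem proposition3p6 {G : Type*} [Group G] (H : Subgroup G) (hH : H.HasDiagonalStabilizers)
    (n : ℕ) (hn : 1 ≤ n) : TCD (MilnorB H n) ≤ TCD (MilnorB G n) := by
  refine TCD_le_of_isDSubset_preimage (MilnorB.map H.subtype) fun U hU => ?_
  obtain rfl | hn := hn.eq_or_lt
  · -- Any retraction of sets `G → H` retracts the graph `B₁ G` onto `B₁ H`.
    refine hU.preimage_of_leftInverse _ (MilnorB.mapOne (Function.invFun H.subtype)) ?_
    exact MilnorB.mapOne_comp_map _ _ (Function.leftInverse_invFun H.subtype_injective)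
  · exact MilnorB.isDSubset_preimage_map_subtype hH hn hU
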